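/- Let $A\in\mathbb R^{m\times n}$ have singular values $\sigma_1\ge\sigma_2\ge\cdots\ge\sigma_n\ge 0$ (the square roots of the eigenvalues of $A^TA$), let $k\ge 2$ be a target rank, $p>2$ an integer oversampling parameter, and $\ell=k+p$. Let $\Omega\in\mathbb R^{n\times\ell}$ be a standard Gaussian random matrix (independent $N(0,1)$ entries). Run the randomized QLP algorithm (RQLP): form $Y=A\Omega$; orthonormalize the columns of $Y$ to get a random matrix $V\in\mathbb R^{m\times\ell}$ with $V^TV=I$ whose column space contains that of $Y$ (so necessarily $\ell\le m$); put $B=V^TA$; compute a pivoted QLP decomposition $B=Q_BLP_B^T$, that is, two column pivoted QR decompositions $B\Pi_0=Q_0R_0$ and $R_0^T\Pi_1=Q_1L^T$, with $\Pi_0,\Pi_1$ permutation matrices, $Q_0,Q_1$ with orthonormal columns and $R_0,L^T$ upper triangular (trapezoidal), and $Q_B=Q_0\Pi_1$, $P_B=\Pi_0Q_1$; finally put $Q=VQ_B$ and $P=P_B$. Then the Frobenius error $\|A-QLP^T\|_F$ is integrable and $$\mathbb E\,\|A-QLP^T\|_F\;\le\;\Bigl(1+\frac{k}{p-1}\Bigr)^{1/2}\Bigl(\sum_{j=k+1}^{n}\sigma_j^2\Bigr)^{1/2}.$$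 -/

import Mathlib

open MeasureTheory ProbabilityTheory
open scoped Matrix Matrix.Norms.Frobenius

/-- `G` is a standard Gaussian random matrix: its entries are independent `N(0,1)` variables. -/
def IsGaussianMatrix {S : Type*} [MeasurableSpace S] (μ : Measure S) {n l : ℕ}
    (G : S → Matrix (Fin n) (Fin l) ℝ) : Prop :=
  (∀ i j, HasLaw (fun ω => G ω i j) (gaussianReal 0 1) μ) ∧
    iIndepFun (fun (ij : Fin n × Fin l) ω => G ω ij.1 ij.2) μ

/-- `V` is an output of the range finder for `A` with the test matrix `G`: `V` has orthonormal
columns, and they come from orthonormalizing the sample `Y = A G`, that is, the columns of `Y` lie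
in the column space of `V`.  (For `Y` of full column rank the two column spaces then agree; for a
rank-deficient `Y` the orthonormal system is completed arbitrarily, as in a QR decomposition.) -/
def IsRangeFinder {m n l : ℕ} (A : Matrix (Fin m) (Fin n) ℝ) (G : Matrix (Fin n) (Fin l) ℝ)
    (V : Matrix (Fin m) (Fin l) ℝ) : Prop :=
  Vᵀ * V = 1 ∧ ∃ S : Matrix (Fin l) (Fin l) ℝ, A * G = V * S

/-- A column pivoted QR decomposition `M Π = Q R`: `Π` is the permutation matrix of `π`, `Q` has
orthonormal columns, `R` is upper triangular (trapezoidal).  The inner dimension `r` is left free,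
which covers the full (`r = a`) and the economy-size (`r = min a b`) forms, and no particular
pivoting strategy is imposed. -/
def IsCPQR {a b r : ℕ} (M : Matrix (Fin a) (Fin b) ℝ) (Q : Matrix (Fin a) (Fin r) ℝ)
    (R : Matrix (Fin r) (Fin b) ℝ) (π : Equiv.Perm (Fin b)) : Prop :=
  M * π.permMatrix ℝ = Q * R ∧ Qᵀ * Q = 1 ∧
    ∀ (i : Fin r) (j : Fin b), (j : ℕ) < (i : ℕ) → R i j = 0

/-- A pivoted QLP decomposition of `B` into `Q`, `L`, `P`: first `B Π₀ = Q₀ R₀`, then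
`R₀ᵀ Π₁ = Q₁ Lᵀ` (two column pivoted QR decompositions), and `Q = Q₀ Π₁`, `P = Π₀ Q₁`. -/
def IsPivotedQLP {l n r s : ℕ} (B : Matrix (Fin l) (Fin n) ℝ) (Q : Matrix (Fin l) (Fin r) ℝ)
    (L : Matrix (Fin r) (Fin s) ℝ) (P : Matrix (Fin n) (Fin s) ℝ) : Prop :=
  ∃ (Q₀ : Matrix (Fin l) (Fin r) ℝ) (R₀ : Matrix (Fin r) (Fin n) ℝ) (π₀ : Equiv.Perm (Fin n))
    (Q₁ : Matrix (Fin n) (Fin s) ℝ) (π₁ : Equiv.Perm (Fin r)),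
    IsCPQR B Q₀ R₀ π₀ ∧ IsCPQR R₀ᵀ Q₁ Lᵀ π₁ ∧
      Q = Q₀ * π₁.permMatrix ℝ ∧ P = π₀.permMatrix ℝ * Q₁

/-- `Q`, `L`, `P` is an output of the randomized QLP algorithm on `A` with test matrix `G` and
intermediate orthonormal matrix `V`: `V` comes from the range finder, `B = Vᵀ A` is given a pivoted
QLP decomposition `Q_B`, `L`, `P`, and `Q = V Q_B`. -/
def IsRQLP {m n l r s : ℕ} (A : Matrix (Fin m) (Fin n) ℝ) (G : Matrix (Fin n) (Fin l) ℝ)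
    (V : Matrix (Fin m) (Fin l) ℝ) (Q : Matrix (Fin m) (Fin r) ℝ)
    (L : Matrix (Fin r) (Fin s) ℝ) (P : Matrix (Fin n) (Fin s) ℝ) : Prop :=
  IsRangeFinder A G V ∧
    ∃ QB : Matrix (Fin l) (Fin r) ℝ, IsPivotedQLP (Vᵀ * A) QB L P ∧ Q = V * QB

/-- `singularValue A i` is the `i`-th singular value of `A` in descending order, counted from `0`:
the usual `σ_j` is `singularValue A (j - 1)`. -/
noncomputable def singularValue {m n : ℕ} (A : Matrix (Fin m) (Fin n) ℝ) (i : ℕ) : ℝ :=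
  (Matrix.toEuclideanLin A).singularValues i

/-! The pivoted QLP step is exact, so `Q * L * Pᵀ = V * Vᵀ * A`, and the whole error is the range
finder error `W * A` with `W = 1 - V * Vᵀ`, an orthogonal projection annihilating `A * G`.

Let `w` be a right singular basis of `A` and `g i = Gᵀ (w i)`. By rotation invariance the `g i` are
independent standard Gaussian vectors in dimension `k + p`. Call the indices below `k` the head and
the others the tail. Almost surely the head rows are linearly independent, so they have a dual
system `d c` with `⟪g a, d c⟫ = δ`. Then `G (d c)` equals `w c` plus the tail combination `∑ ⟪g i, d
c⟫ • w i`. Since `W * A` kills it, `‖W A (w c)‖` is at most the norm of `∑ ⟪g i, d c⟫ • A (w i)`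
over the tail (`IsRangeFinder.norm_sub_sq_le`).

Tail rows are independent of head rows, so averaging over the tail turns each squared norm into `‖d
c‖ ^ 2 * ∑ ‖A (w i)‖ ^ 2`. For the dual vector in the span of the head rows, `‖d c‖⁻¹` is the
distance from `g c` to the span of the other head rows. Its square dominates a chi-squared variable
with `p + 1` degrees of freedom, whose inverse has mean `1 / (p - 1)`
(`lintegral_norm_gramDual_sq_le`). Summing over at most `k` head indices bounds the mean squared
error, and Jensen's inequality gives the bound on the mean. -/

open scoped RealInnerProductSpace ENNReal

/-! ### Orthonormal images of Gaussian vectors -/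

/-- A family of linear images of a standard Gaussian vector whose joint map is a co-isometry
consists of independent vectors with standard Gaussian characteristic functions. -/
theorem map_stdGaussian_eq_pi {ι H E : Type*} [Fintype ι]
    [NormedAddCommGroup H] [InnerProductSpace ℝ H] [FiniteDimensional ℝ H]
    [MeasurableSpace H] [BorelSpace H]
    [NormedAddCommGroup E] [InnerProductSpace ℝ E] [FiniteDimensional ℝ E]
    [MeasurableSpace E] [BorelSpace E] (ν : Measure E) [IsProbabilityMeasure ν]
    (hν : ∀ t, charFun ν t = Complex.exp (-‖t‖ ^ 2 / 2))
    (f : ι → H → E) (hf : ∀ i, Measurable (f i))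
    (h : ∀ t : ι → E, ∃ u : H, (∀ x, ∑ i, ⟪f i x, t i⟫ = ⟪x, u⟫) ∧ ‖u‖ ^ 2 = ∑ i, ‖t i‖ ^ 2) :
    (stdGaussian H).map (fun x i => f i x) = Measure.pi fun _ => ν := by
  have hm : Measurable fun x i => f i x := measurable_pi_iff.2 hf
  have : IsProbabilityMeasure ((stdGaussian H).map fun x i => f i x) :=
    Measure.isProbabilityMeasure_map hm.aemeasurable
  -- The joint characteristic function at `t` is `exp (-‖u‖ ^ 2 / 2)`, which factors over `i`
  -- because `‖u‖ ^ 2` is the sum of the `‖t i‖ ^ 2`.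
  rw [← charFun_eq_pi_iff]
  intro t
  obtain ⟨u, hu, hun⟩ := h t
  rw [Measure.map_map (by fun_prop) hm, charFun_apply, integral_map (by fun_prop) (by fun_prop)]
  have h1 : ∀ x : H, ⟪((WithLp.toLp 2 ∘ fun x i => f i x) x : PiLp 2 fun _ : ι => E), t⟫
      = ⟪x, u⟫ := by
    intro x
    rw [← hu x, PiLp.inner_apply]
    rfl
  simp_rw [h1, ← charFun_apply, charFun_stdGaussian, hν, ← Complex.exp_sum, ← Complex.ofReal_pow,
    hun]
  simp [Finset.sum_div, neg_div]

theorem map_stdGaussian_inner_orthonormal {ι E : Type*} [Fintype ι]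
    [NormedAddCommGroup E] [InnerProductSpace ℝ E] [FiniteDimensional ℝ E]
    [MeasurableSpace E] [BorelSpace E] {b : ι → E} (hb : Orthonormal ℝ b) :
    (stdGaussian E).map (fun x i => ⟪b i, x⟫) = Measure.pi fun _ => gaussianReal 0 1 := by
  refine map_stdGaussian_eq_pi (gaussianReal 0 1) (fun t => ?_) (fun i x => ⟪b i, x⟫)
    (fun i => by fun_prop) fun t => ⟨∑ i, t i • b i, fun x => ?_, ?_⟩
  · rw [charFun_gaussianReal]
    congr 1
    simp [← Complex.ofReal_pow, neg_div]
  · simp [inner_sum, real_inner_smul_right, real_inner_comm]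
  · rw [← real_inner_self_eq_norm_sq, hb.inner_sum]
    simp [sq]

/-! ### The inverse moment of a chi-squared variable -/

theorem integral_exp_neg_mul_sq_gaussianReal {t : ℝ} (ht : 0 ≤ t) :
    ∫ x, Real.exp (-t * x ^ 2) ∂gaussianReal 0 1 = (1 + 2 * t) ^ (-(1 / 2) : ℝ) := by
  rw [integral_gaussianReal_eq_integral_smul one_ne_zero]
  have h1 : ∀ x : ℝ, gaussianPDFReal 0 1 x • Real.exp (-t * x ^ 2)
      = (√(2 * Real.pi))⁻¹ * Real.exp (-(1 / 2 + t) * x ^ 2) := by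
    intro x
    rw [gaussianPDFReal, smul_eq_mul, mul_assoc, ← Real.exp_add]
    congr 2
    · simp
    · simp; ring
  simp_rw [h1]
  rw [integral_const_mul, integral_gaussian, ← Real.sqrt_inv, ← Real.sqrt_mul (by positivity),
    Real.rpow_neg (by positivity), ← Real.sqrt_eq_rpow, ← Real.sqrt_inv]
  congr 1
  field_simp

theorem lintegral_exp_neg_mul_sum_sq {d : ℕ} {t : ℝ} (ht : 0 ≤ t) :
    ∫⁻ x : Fin d → ℝ, ENNReal.ofReal (Real.exp (-t * ∑ i, x i ^ 2))
        ∂Measure.pi (fun _ => gaussianReal 0 1)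
      = ENNReal.ofReal ((1 + 2 * t) ^ (-(d / 2) : ℝ)) := by
  rw [← ofReal_integral_eq_lintegral_ofReal]
  · congr 1
    simp_rw [Finset.mul_sum, Real.exp_sum]
    rw [integral_fintype_prod_eq_prod (𝕜 := ℝ) (fun _ x => Real.exp (-t * x ^ 2))]
    simp_rw [integral_exp_neg_mul_sq_gaussianReal ht]
    rw [Finset.prod_const, ← Real.rpow_natCast, ← Real.rpow_mul (by positivity)]
    congr 1
    simp; ring
  · refine Integrable.of_bound (C := 1) (Measurable.aestronglyMeasurable (by fun_prop)) (ae_of_all _ fun x => ?_)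
    rw [Real.norm_of_nonneg (by positivity), Real.exp_le_one_iff]
    have := Finset.sum_nonneg fun i (_ : i ∈ Finset.univ) => sq_nonneg (x i)
    nlinarith
  · exact ae_of_all _ fun x => by positivity

/-- This turns an inverse moment into an integral of Laplace transforms, which factor over
coordinates. At `q = 0` both sides are infinite, so no null set has to be removed. -/
theorem lintegral_exp_neg_mul_Ioi {q : ℝ} (hq : 0 ≤ q) :
    ∫⁻ t in Set.Ioi (0 : ℝ), ENNReal.ofReal (Real.exp (-t * q)) = (ENNReal.ofReal q)⁻¹ := by
  rcases hq.eq_or_lt with rfl | hq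
  · simp
  · have h1 : ∀ t : ℝ, -t * q = -q * t := fun t => by ring
    simp_rw [h1]
    rw [← ofReal_integral_eq_lintegral_ofReal (integrableOn_exp_mul_Ioi (by linarith) 0)
      (ae_of_all _ fun x => by positivity), integral_exp_mul_Ioi (by linarith),
      ← ENNReal.ofReal_inv_of_pos hq]
    simp

theorem lintegral_one_add_two_mul_rpow_Ioi {d : ℕ} (hd : 3 ≤ d) :
    ∫⁻ t in Set.Ioi (0 : ℝ), ENNReal.ofReal ((1 + 2 * t) ^ (-(d / 2) : ℝ))
      = ENNReal.ofReal (1 / ((d : ℝ) - 2)) := by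
  have hd' : (3 : ℝ) ≤ d := by exact_mod_cast hd
  have hderiv : ∀ x ∈ Set.Ici (0 : ℝ),
      HasDerivAt (fun t : ℝ => -(1 / ((d : ℝ) - 2)) * (1 + 2 * t) ^ (1 - d / 2 : ℝ))
        ((1 + 2 * x) ^ (-(d / 2) : ℝ)) x := by
    intro x hx
    have hx' : (0 : ℝ) ≤ x := hx
    have h1 : HasDerivAt (fun t : ℝ => 1 + 2 * t) 2 x := by
      simpa using ((hasDerivAt_id x).const_mul 2).const_add 1
    have h2 := (h1.rpow_const (p := (1 - d / 2 : ℝ)) (Or.inl (by positivity))).const_mul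
      (-(1 / ((d : ℝ) - 2)))
    convert! h2 using 1
    have h3 : (d : ℝ) - 2 ≠ 0 := by linarith
    rw [show (1 - d / 2 - 1 : ℝ) = -(d / 2) by ring]
    field_simp
    ring
  have hpos : ∀ x ∈ Set.Ioi (0 : ℝ), 0 ≤ (1 + 2 * x) ^ (-(d / 2) : ℝ) := fun x hx => by
    have : (0 : ℝ) < x := hx
    positivity
  have hlim : Filter.Tendsto
      (fun t : ℝ => -(1 / ((d : ℝ) - 2)) * (1 + 2 * t) ^ (1 - d / 2 : ℝ)) Filter.atTop
      (nhds (-(1 / ((d : ℝ) - 2)) * 0)) := by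
    -- The exponent `1 - d / 2` is negative because `d ≥ 3`.
    refine Filter.Tendsto.const_mul _ ?_
    have h4 := tendsto_rpow_neg_atTop (y := (d / 2 - 1 : ℝ)) (by linarith)
    rw [neg_sub] at h4
    refine h4.comp (Filter.tendsto_atTop_add_const_left _ _ ?_)
    exact Filter.tendsto_id.const_mul_atTop two_pos
  rw [← ofReal_integral_eq_lintegral_ofReal (integrableOn_Ioi_deriv_of_nonneg' hderiv hpos hlim)
    ((ae_restrict_iff' measurableSet_Ioi).2 (ae_of_all _ hpos)),
    integral_Ioi_of_hasDerivAt_of_nonneg' hderiv hpos hlim]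
  simp

/-- The mean of the inverse of a chi-squared variable with `d ≥ 3` degrees of freedom. -/
theorem lintegral_inv_sum_sq_gaussianReal {d : ℕ} (hd : 3 ≤ d) :
    ∫⁻ x : Fin d → ℝ, (ENNReal.ofReal (∑ i, x i ^ 2))⁻¹ ∂Measure.pi (fun _ => gaussianReal 0 1)
      = ENNReal.ofReal (1 / ((d : ℝ) - 2)) := by
  have h1 : ∀ x : Fin d → ℝ, (ENNReal.ofReal (∑ i, x i ^ 2))⁻¹
      = ∫⁻ t in Set.Ioi (0 : ℝ), ENNReal.ofReal (Real.exp (-t * ∑ i, x i ^ 2)) := fun x =>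
    (lintegral_exp_neg_mul_Ioi (Finset.sum_nonneg fun i _ => sq_nonneg (x i))).symm
  simp_rw [h1]
  rw [lintegral_lintegral_swap (by fun_prop), ← lintegral_one_add_two_mul_rpow_Ioi hd]
  exact setLIntegral_congr_fun measurableSet_Ioi fun t ht =>
    lintegral_exp_neg_mul_sum_sq (le_of_lt ht)

theorem lintegral_inv_sum_inner_sq_stdGaussian {E : Type*}
    [NormedAddCommGroup E] [InnerProductSpace ℝ E] [FiniteDimensional ℝ E]
    [MeasurableSpace E] [BorelSpace E] {d : ℕ} (hd : 3 ≤ d) {b : Fin d → E}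
    (hb : Orthonormal ℝ b) :
    ∫⁻ g, (ENNReal.ofReal (∑ i, ⟪b i, g⟫ ^ 2))⁻¹ ∂stdGaussian E
      = ENNReal.ofReal (1 / ((d : ℝ) - 2)) := by
  rw [← lintegral_inv_sum_sq_gaussianReal hd, ← map_stdGaussian_inner_orthonormal hb,
    lintegral_map (by fun_prop) (by fun_prop)]

/-! ### Second moments of Gaussian combinations -/

theorem integral_sq_sum_inner_stdGaussian {ι E : Type*} [Fintype ι]
    [NormedAddCommGroup E] [InnerProductSpace ℝ E] [FiniteDimensional ℝ E]
    [MeasurableSpace E] [BorelSpace E] (v : E) (c : ι → ℝ) :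
    Integrable (fun x : ι → E => (∑ i, ⟪x i, v⟫ * c i) ^ 2) (Measure.pi fun _ => stdGaussian E) ∧
    ∫ x : ι → E, (∑ i, ⟪x i, v⟫ * c i) ^ 2 ∂Measure.pi (fun _ => stdGaussian E)
      = ‖v‖ ^ 2 * ∑ i, c i ^ 2 := by
  have hL : ∀ i, (fun g : E => ⟪g, v⟫ * c i) = ⇑(c i • innerSL ℝ v) := fun i => by
    ext g; simp [real_inner_comm, mul_comm]
  have hmem : ∀ i, MemLp (fun g : E => ⟪g, v⟫ * c i) 2 (stdGaussian E) := fun i => by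
    rw [hL]
    exact IsGaussian.memLp_dual _ _ _ (by simp)
  have hmem' : ∀ i, MemLp (fun x : ι → E => ⟪x i, v⟫ * c i) 2
      (Measure.pi fun _ => stdGaussian E) := fun i =>
    (hmem i).comp_measurePreserving (measurePreserving_eval (fun _ => stdGaussian E) i)
  have hsum : MemLp (fun x : ι → E => ∑ i, ⟪x i, v⟫ * c i) 2
      (Measure.pi fun _ => stdGaussian E) := memLp_finsetSum _ fun i _ => hmem' i
  refine ⟨hsum.integrable_sq, ?_⟩
  have hzero : ∫ x : ι → E, ∑ i, ⟪x i, v⟫ * c i ∂Measure.pi (fun _ => stdGaussian E) = 0 := by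
    rw [integral_finsetSum _ fun i _ => (hmem' i).integrable one_le_two]
    refine Finset.sum_eq_zero fun i _ => ?_
    rw [integral_comp_eval (μ := fun _ : ι => stdGaussian E) (i := i)
      (f := fun g : E => ⟪g, v⟫ * c i) (hmem i).aestronglyMeasurable, hL]
    exact integral_strongDual_stdGaussian _
  -- For a centred sum the second moment is the variance, which is additive over independent
  -- coordinates.
  rw [← variance_of_integral_eq_zero hsum.aemeasurable hzero]
  have h2 := variance_sum_pi (μ := fun _ : ι => stdGaussian E)
    (X := fun i (g : E) => ⟪g, v⟫ * c i) hmem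
  have h3 : (∑ i, fun x : ι → E => ⟪x i, v⟫ * c i) = fun x => ∑ i, ⟪x i, v⟫ * c i := by
    ext x; simp
  rw [h3] at h2
  rw [h2, Finset.mul_sum]
  refine Finset.sum_congr rfl fun i _ => ?_
  rw [hL, variance_dual_stdGaussian, norm_smul, innerSL_apply_norm]
  rw [mul_pow, Real.norm_eq_abs, sq_abs, mul_comm]

/-- The mean squared norm of a Gaussian combination of fixed vectors. -/
theorem lintegral_norm_sum_inner_smul_sq {ι E : Type*} [Fintype ι]
    [NormedAddCommGroup E] [InnerProductSpace ℝ E] [FiniteDimensional ℝ E]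
    [MeasurableSpace E] [BorelSpace E] {m : ℕ} (v : E) (a : ι → EuclideanSpace ℝ (Fin m)) :
    ∫⁻ x : ι → E, ENNReal.ofReal (‖∑ i, ⟪x i, v⟫ • a i‖ ^ 2) ∂Measure.pi (fun _ => stdGaussian E)
      = ENNReal.ofReal (‖v‖ ^ 2 * ∑ i, ‖a i‖ ^ 2) := by
  have h1 : ∀ x : ι → E, ‖∑ i, ⟪x i, v⟫ • a i‖ ^ 2 = ∑ j, (∑ i, ⟪x i, v⟫ * a i j) ^ 2 := by
    intro x
    rw [EuclideanSpace.real_norm_sq_eq]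
    simp
  simp_rw [h1]
  have h2 := fun j => integral_sq_sum_inner_stdGaussian (ι := ι) v fun i => a i j
  rw [← ofReal_integral_eq_lintegral_ofReal (integrable_finsetSum _ fun j _ => (h2 j).1)
    (ae_of_all _ fun x => by positivity), integral_finsetSum _ fun j _ => (h2 j).1]
  simp_rw [fun j => (h2 j).2, ← Finset.mul_sum, EuclideanSpace.real_norm_sq_eq]
  rw [Finset.sum_comm]

/-- Tonelli, integrating coordinate `i` first: a bound uniform in the frozen coordinates survives
averaging over them. -/
theorem lintegral_pi_le_of_lintegral_update_le {ι : Type*} [Fintype ι] [DecidableEq ι]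
    {X : ι → Type*} [∀ i, MeasurableSpace (X i)] (μ : ∀ i, Measure (X i))
    [∀ i, IsProbabilityMeasure (μ i)] {f : (∀ i, X i) → ℝ≥0∞} (hf : Measurable f) (i : ι)
    {C : ℝ≥0∞} (h : ∀ x, ∫⁻ y, f (Function.update x i y) ∂μ i ≤ C) :
    ∫⁻ x, f x ∂Measure.pi μ ≤ C := by
  have hne : Nonempty (∀ i, X i) := (Measure.pi μ).nonempty_of_neZero
  obtain ⟨x₀⟩ := hne
  rw [lintegral_eq_lmarginal_univ x₀, lmarginal_erase' _ hf (Finset.mem_univ i)]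
  calc _ ≤ (∫⋯∫⁻_(Finset.univ.erase i), (fun _ => C) ∂μ) x₀ :=
        lmarginal_mono (fun x => h x) x₀
    _ = C := by simp [lmarginal]

/-! ### Dual systems and orthogonal complements -/

section InnerProductSpace

variable {E : Type*} [NormedAddCommGroup E] [InnerProductSpace ℝ E]

/-- The member with index `c` of the system dual to `x` in the span of `x`. -/
noncomputable def gramDual {ι : Type*} [Fintype ι] [DecidableEq ι] (x : ι → E) (c : ι) : E :=
  ∑ b, (Matrix.gram ℝ x)⁻¹ b c • x b

theorem inner_gramDual {ι : Type*} [Fintype ι] [DecidableEq ι] {x : ι → E}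
    (hx : LinearIndependent ℝ x) (a c : ι) :
    ⟪x a, gramDual x c⟫ = if a = c then 1 else 0 := by
  have h := Matrix.mul_nonsing_inv (Matrix.gram ℝ x)
    (isUnit_iff_ne_zero.2 (Matrix.det_gram_ne_zero_iff_linearIndependent.2 hx))
  have h1 := congrFun (congrFun h a) c
  rw [Matrix.mul_apply, Matrix.one_apply] at h1
  rw [gramDual, inner_sum, ← h1]
  exact Finset.sum_congr rfl fun b _ => by rw [real_inner_smul_right, Matrix.gram_apply, mul_comm]

/-- Among the solutions of the dual equations, the one in the span of `x` is shortest: any other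
differs from it by a vector orthogonal to the span. For dependent `x` the inverse Gram matrix is
zero by convention, hence so is `gramDual`. -/
theorem norm_gramDual_le {ι : Type*} [Fintype ι] [DecidableEq ι] {x : ι → E} {c : ι} {v : E}
    (hv : ∀ a, ⟪x a, v⟫ = if a = c then 1 else 0) : ‖gramDual x c‖ ≤ ‖v‖ := by
  by_cases hx : LinearIndependent ℝ x
  · have h1 : ⟪gramDual x c, v⟫ = ⟪gramDual x c, gramDual x c⟫ := by
      have h2 : ∀ w, ⟪gramDual x c, w⟫ = ∑ b, (Matrix.gram ℝ x)⁻¹ b c * ⟪x b, w⟫ := fun w => by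
        rw [gramDual, sum_inner]
        exact Finset.sum_congr rfl fun b _ => real_inner_smul_left _ _ _
      rw [h2, h2]
      exact Finset.sum_congr rfl fun b _ => by rw [hv, inner_gramDual hx]
    have h2 := real_inner_le_norm (gramDual x c) v
    rw [h1, real_inner_self_eq_norm_mul_norm] at h2
    by_contra! h3
    nlinarith [norm_nonneg v]
  · have h1 : (Matrix.gram ℝ x)⁻¹ = 0 := by
      rw [← Matrix.det_gram_ne_zero_iff_linearIndependent, not_not] at hx
      exact Matrix.nonsing_inv_apply_not_isUnit _ (by rw [hx]; exact not_isUnit_zero)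
    have h2 : ∀ b, (Matrix.gram ℝ x)⁻¹ b c = 0 := fun b => by rw [h1]; rfl
    simp only [gramDual, h2, zero_smul, Finset.sum_const_zero, norm_zero, norm_nonneg]

theorem exists_orthonormal_fin_orthogonal [FiniteDimensional ℝ E] {K : Submodule ℝ E} {d : ℕ}
    (hd : Module.finrank ℝ K + d ≤ Module.finrank ℝ E) :
    ∃ b : Fin d → E, Orthonormal ℝ b ∧ ∀ i, b i ∈ Kᗮ := by
  have h1 := K.finrank_add_finrank_orthogonal
  have hle : d ≤ Module.finrank ℝ Kᗮ := by omega
  refine ⟨fun i => (stdOrthonormalBasis ℝ Kᗮ (Fin.castLE hle i) : E), ?_, fun i => Subtype.coe_prop _⟩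
  exact ((stdOrthonormalBasis ℝ Kᗮ).orthonormal.comp_linearIsometry Kᗮ.subtypeₗᵢ).comp _
    (Fin.castLE_injective hle)

end InnerProductSpace

/-! ### Gaussian systems of vectors: independence and dual norms -/

section Gaussian

variable {E : Type*} [NormedAddCommGroup E] [InnerProductSpace ℝ E] [FiniteDimensional ℝ E]
    [MeasurableSpace E] [BorelSpace E]

/-- The component along a unit normal to `K` has law `N(0,1)`, which has no atom at zero. -/
theorem stdGaussian_submodule_eq_zero {K : Submodule ℝ E} (hK : K ≠ ⊤) :
    stdGaussian E K = 0 := by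
  obtain ⟨u, hu, hu0⟩ := Submodule.exists_mem_ne_zero_of_ne_bot
    (mt (Submodule.orthogonal_eq_bot_iff (K := K)).1 hK)
  have hb : Orthonormal ℝ (fun _ : Fin 1 => ‖u‖⁻¹ • u) := by
    refine ⟨fun _ => ?_, fun i j hij => (hij (Subsingleton.elim i j)).elim⟩
    rw [norm_smul, norm_inv, norm_norm, inv_mul_cancel₀ (norm_ne_zero_iff.2 hu0)]
  have h1 := map_stdGaussian_inner_orthonormal hb
  have hna : NullSingletonClass (gaussianReal (0 : ℝ) 1) := nullSingletonClass_gaussianReal one_ne_zero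
  have h2 : Measure.pi (fun _ : Fin 1 => gaussianReal 0 1) {x | x 0 = 0} = 0 :=
    Measure.pi_hyperplane (fun _ : Fin 1 => gaussianReal 0 1) 0 0
  rw [← h1, Measure.map_apply (by fun_prop)
    (measurableSet_eq_fun (by fun_prop) (by fun_prop))] at h2
  refine measure_mono_null (fun g hg => ?_) h2
  simp [real_inner_smul_left, Submodule.inner_left_of_mem_orthogonal hg hu]

theorem measurableSet_linearIndepOn {ι : Type*} [Fintype ι] (s : Set ι) :
    MeasurableSet {x : ι → E | LinearIndepOn ℝ x s} := by
  have h : IsOpen {f : s → E | LinearIndependent ℝ f} := isOpen_setOfPred_linearIndependent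
  exact (h.preimage (f := fun (x : ι → E) (i : s) => x i) (by fun_prop)).measurableSet

theorem ae_linearIndepOn_stdGaussian {ι : Type*} [Fintype ι] [DecidableEq ι] (s : Finset ι)
    (hs : s.card ≤ Module.finrank ℝ E) :
    ∀ᵐ x ∂Measure.pi (fun _ : ι => stdGaussian E), LinearIndepOn ℝ x (s : Set ι) := by
  classical
  induction s using Finset.induction_on with
  | empty => simp
  | insert i s hi ih =>
    rw [Finset.card_insert_of_notMem hi] at hs
    have hmeas : MeasurableSet {x : ι → E | LinearIndepOn ℝ x (s : Set ι) ∧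
        ¬ LinearIndepOn ℝ x (insert i s : Set ι)} :=
      (measurableSet_linearIndepOn _).inter (measurableSet_linearIndepOn _).compl
    -- Resampling `x i` alone, independence breaks only if the new vector falls in the span of the
    -- others in `s`, which is proper by cardinality and hence null.
    have hle := lintegral_pi_le_of_lintegral_update_le (fun _ : ι => stdGaussian E)
      (measurable_const.indicator hmeas (f := fun _ => (1 : ℝ≥0∞))) i (C := 0) (by
        intro x
        have himg : ∀ y, Function.update x i y '' (s : Set ι) = x '' s := fun y =>
          Set.image_congr fun j hj => Function.update_of_ne
            (fun h => hi (by simpa [h] using hj)) _ _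
        have hK : Submodule.span ℝ (x '' (s : Set ι)) ≠ ⊤ := by
          intro h
          have h1 := finrank_span_finset_le_card (R := ℝ) (s.image x)
          rw [Finset.coe_image, Set.finrank, h, finrank_top] at h1
          have h2 := Finset.card_image_le (s := s) (f := x)
          omega
        calc _ ≤ ∫⁻ y, (Submodule.span ℝ (x '' (s : Set ι)) : Set E).indicator
              (fun _ => 1) y ∂stdGaussian E := by
              refine lintegral_mono fun y => ?_
              by_cases hy : y ∈ Submodule.span ℝ (x '' (s : Set ι))
              · rw [Set.indicator_of_mem (show y ∈ (_ : Set E) from hy)]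
                exact Set.indicator_le_self' (fun _ _ => zero_le_one) _
              · rw [Set.indicator_of_notMem]
                · exact zero_le
                rintro ⟨h1, h2⟩
                refine h2 ((linearIndepOn_insert (by simpa using hi)).2 ⟨h1, ?_⟩)
                rwa [himg, Function.update_self]
            _ ≤ 0 := by
              rw [lintegral_indicator_const
                (Submodule.closed_of_finiteDimensional _).measurableSet,
                stdGaussian_submodule_eq_zero hK, mul_zero])
    rw [lintegral_indicator_const hmeas, one_mul, nonpos_iff_eq_zero] at hle
    filter_upwards [ih (by omega), measure_eq_zero_iff_ae_notMem.1 hle] with x h1 h2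
    rw [Finset.coe_insert]
    by_contra h3
    exact h2 ⟨h1, h3⟩

theorem measurable_gramDual {ι : Type*} [Fintype ι] [DecidableEq ι] (c : ι) :
    Measurable fun x : ι → E => gramDual x c := by
  have hg : Continuous fun x : ι → E => Matrix.gram ℝ x := by
    refine continuous_matrix fun i j => ?_
    simp only [Matrix.gram_apply]
    fun_prop
  simp only [gramDual]
  refine Finset.measurable_sum _ fun b _ => ?_
  have h1 : Measurable fun x : ι → E => (Matrix.gram ℝ x).det := hg.matrix_det.measurable
  have h2 : Measurable fun x : ι → E => (Matrix.gram ℝ x).adjugate b c :=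
    (hg.matrix_adjugate.matrix_elem b c).measurable
  have h3 : Measurable fun x : ι → E => (Matrix.gram ℝ x)⁻¹ b c := by
    -- This formula also holds for singular Gram matrices, where both sides vanish, so measurability
    -- needs no case split.
    have h4 : ∀ x : ι → E, (Matrix.gram ℝ x)⁻¹ b c
        = (Matrix.gram ℝ x).det⁻¹ * (Matrix.gram ℝ x).adjugate b c := fun x => by
      rw [Matrix.inv_def, Ring.inverse_eq_inv', Matrix.smul_apply, smul_eq_mul]
    simp_rw [h4]
    exact h1.inv.mul h2
  exact h3.smul (measurable_pi_apply b)

/-- The mean squared norm of a member of the dual system of a Gaussian system of vectors. -/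
theorem lintegral_norm_gramDual_sq_le {ι : Type*} [Fintype ι] [DecidableEq ι] (c : ι) {d : ℕ}
    (hd : 3 ≤ d) (hE : Fintype.card ι + d ≤ Module.finrank ℝ E + 1) :
    ∫⁻ x : ι → E, ENNReal.ofReal (‖gramDual x c‖ ^ 2) ∂Measure.pi (fun _ => stdGaussian E)
      ≤ ENNReal.ofReal (1 / ((d : ℝ) - 2)) := by
  refine lintegral_pi_le_of_lintegral_update_le (fun _ : ι => stdGaussian E)
    ((measurable_gramDual c).norm.pow_const 2).ennreal_ofReal c fun x => ?_
  classical
  let s : Finset E := (Finset.univ.erase c).image x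
  have hs : s.card + 1 ≤ Fintype.card ι := by
    have h1 : s.card ≤ (Finset.univ.erase c).card := Finset.card_image_le
    rw [Finset.card_erase_of_mem (Finset.mem_univ c), Finset.card_univ] at h1
    have := Fintype.card_pos_iff.2 ⟨c⟩
    omega
  have hfin : Module.finrank ℝ (Submodule.span ℝ (s : Set E)) ≤ s.card := finrank_span_finset_le_card s
  -- The other vectors span at most `card ι - 1` dimensions, leaving room for `d` orthonormal
  -- directions `b`.
  obtain ⟨b, hb, hbK⟩ := exists_orthonormal_fin_orthogonal
    (K := Submodule.span ℝ (s : Set E)) (d := d) (by omega)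
  rw [← lintegral_inv_sum_inner_sq_stdGaussian hd hb]
  refine lintegral_mono fun g => ?_
  set q := ∑ i, ⟪b i, g⟫ ^ 2 with hq
  have hq0 : 0 ≤ q := Finset.sum_nonneg fun i _ => sq_nonneg _
  rcases hq0.eq_or_lt with h0 | hpos
  · simp [← h0]
  rw [← ENNReal.ofReal_inv_of_pos hpos]
  refine ENNReal.ofReal_le_ofReal ?_
  -- The competitor is the projection of `g` onto the span of `b`, divided by its squared norm `q`.
  -- It is orthogonal to the other vectors, pairs to one with `g`, and has squared norm `q⁻¹`.
  have hle : ‖gramDual (Function.update x c g) c‖ ≤ ‖∑ i, (q⁻¹ * ⟪b i, g⟫) • b i‖ := by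
    refine norm_gramDual_le fun a => ?_
    split_ifs with hac
    · subst hac
      rw [Function.update_self, inner_sum]
      simp_rw [real_inner_smul_right, mul_assoc, ← Finset.mul_sum, real_inner_comm _ g, ← sq]
      exact inv_mul_cancel₀ hpos.ne'
    · rw [Function.update_of_ne hac, inner_sum]
      refine Finset.sum_eq_zero fun i _ => ?_
      rw [real_inner_smul_right, Submodule.inner_right_of_mem_orthogonal _ (hbK i), mul_zero]
      exact Submodule.subset_span (by simpa [s] using ⟨a, hac, rfl⟩)
  calc ‖gramDual (Function.update x c g) c‖ ^ 2
      ≤ ‖∑ i, (q⁻¹ * ⟪b i, g⟫) • b i‖ ^ 2 := by gcongr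
    _ = q⁻¹ := by
      rw [← real_inner_self_eq_norm_sq, hb.inner_sum]
      have : ∀ i, (starRingEnd ℝ) (q⁻¹ * ⟪b i, g⟫) * (q⁻¹ * ⟪b i, g⟫) = q⁻¹ ^ 2 * ⟪b i, g⟫ ^ 2 :=
        fun i => by simp; ring
      simp_rw [this, ← Finset.mul_sum, ← hq]
      field_simp

end Gaussian

/-! ### Deterministic error analysis -/

theorem permMatrix_mul_transpose_self {n : ℕ} (π : Equiv.Perm (Fin n)) :
    π.permMatrix ℝ * (π.permMatrix ℝ)ᵀ = 1 := by
  rw [Matrix.transpose_permMatrix, ← Matrix.permMatrix_mul]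
  simp

/-- A pivoted QLP decomposition reproduces the matrix. -/
theorem IsPivotedQLP.mul_mul_transpose {l n r s : ℕ} {B : Matrix (Fin l) (Fin n) ℝ}
    {Q : Matrix (Fin l) (Fin r) ℝ} {L : Matrix (Fin r) (Fin s) ℝ} {P : Matrix (Fin n) (Fin s) ℝ}
    (h : IsPivotedQLP B Q L P) : Q * L * Pᵀ = B := by
  obtain ⟨Q₀, R₀, π₀, Q₁, π₁, ⟨h0, -, -⟩, ⟨h1, -, -⟩, rfl, rfl⟩ := h
  have hR := congrArg Matrix.transpose h1
  rw [Matrix.transpose_mul, Matrix.transpose_mul, Matrix.transpose_transpose,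
    Matrix.transpose_transpose] at hR
  calc Q₀ * π₁.permMatrix ℝ * L * (π₀.permMatrix ℝ * Q₁)ᵀ
      = Q₀ * (π₁.permMatrix ℝ * (L * Q₁ᵀ)) * (π₀.permMatrix ℝ)ᵀ := by
        simp only [Matrix.transpose_mul, Matrix.mul_assoc]
    _ = B := by
        rw [← hR, ← Matrix.mul_assoc (π₁.permMatrix ℝ), permMatrix_mul_transpose_self,
          Matrix.one_mul, ← h0, Matrix.mul_assoc, permMatrix_mul_transpose_self, Matrix.mul_one]

theorem IsRQLP.mul_mul_transpose {m n l r s : ℕ} {A : Matrix (Fin m) (Fin n) ℝ}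
    {G : Matrix (Fin n) (Fin l) ℝ} {V : Matrix (Fin m) (Fin l) ℝ} {Q : Matrix (Fin m) (Fin r) ℝ}
    {L : Matrix (Fin r) (Fin s) ℝ} {P : Matrix (Fin n) (Fin s) ℝ} (h : IsRQLP A G V Q L P) :
    Q * L * Pᵀ = V * (Vᵀ * A) := by
  obtain ⟨-, QB, hQLP, rfl⟩ := h
  rw [← hQLP.mul_mul_transpose]
  simp only [Matrix.mul_assoc]

theorem frobenius_norm_sq_eq_sum_norm_toEuclideanLin {m n : ℕ} (M : Matrix (Fin m) (Fin n) ℝ)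
    (w : OrthonormalBasis (Fin n) ℝ (EuclideanSpace ℝ (Fin n))) :
    ‖M‖ ^ 2 = ∑ c, ‖Matrix.toEuclideanLin M (w c)‖ ^ 2 := by
  have h1 : ‖M‖ ^ 2 = ∑ i, ∑ j, M i j ^ 2 := by
    rw [Matrix.frobenius_norm_def, ← Real.sqrt_eq_rpow, Real.sq_sqrt (by positivity)]
    simp
  have h2 : ∀ i c, Matrix.toEuclideanLin M (w c) i = ⟪WithLp.toLp 2 (M i), w c⟫ := fun i c => by
    simp [Matrix.toLpLin_apply, Matrix.mulVec, dotProduct, PiLp.inner_apply, mul_comm]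
  simp_rw [EuclideanSpace.real_norm_sq_eq]
  rw [Finset.sum_comm, h1]
  refine Finset.sum_congr rfl fun i _ => ?_
  simp_rw [h2]
  rw [w.sum_sq_inner_left, EuclideanSpace.real_norm_sq_eq]

/-- `W = 1 - V * Vᵀ` is symmetric and idempotent, so `‖W y‖ ^ 2 = ⟪y, W y⟫` and Cauchy–Schwarz
applies. -/
theorem norm_toEuclideanLin_one_sub_mul_transpose_le {m l : ℕ} {V : Matrix (Fin m) (Fin l) ℝ}
    (hV : Vᵀ * V = 1) (y : EuclideanSpace ℝ (Fin m)) :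
    ‖Matrix.toEuclideanLin (1 - V * Vᵀ) y‖ ≤ ‖y‖ := by
  set W : Matrix (Fin m) (Fin m) ℝ := 1 - V * Vᵀ with hW
  have hWt : Wᵀ = W := by simp [hW]
  have hWW : Wᵀ * W = W := by
    have h : V * Vᵀ * (V * Vᵀ) = V * Vᵀ := by
      rw [Matrix.mul_assoc, ← Matrix.mul_assoc Vᵀ, hV, Matrix.one_mul]
    rw [hWt, hW, Matrix.sub_mul, Matrix.mul_sub, Matrix.mul_sub, h]
    simp
  have h1 : ⟪Matrix.toEuclideanLin W y, Matrix.toEuclideanLin W y⟫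
      = ⟪y, Matrix.toEuclideanLin W y⟫ := by
    have h2 : ∀ z : EuclideanSpace ℝ (Fin m), ⟪Matrix.toEuclideanLin W y, z⟫
        = ⟪y, Matrix.toEuclideanLin Wᵀ z⟫ := fun z => by
      rw [← Matrix.conjTranspose_eq_transpose_of_trivial, Matrix.toEuclideanLin_conjTranspose_eq_adjoint,
        LinearMap.adjoint_inner_right]
    rw [h2]
    congr 1
    rw [Matrix.toLpLin_apply, Matrix.toLpLin_apply, Matrix.mulVec_mulVec, hWW]
  have h3 := real_inner_le_norm y (Matrix.toEuclideanLin W y)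
  rw [← h1, real_inner_self_eq_norm_mul_norm] at h3
  by_contra! h4
  nlinarith [norm_nonneg y]

/-- The `i`-th row of `G` after a rotation of `ℝⁿ` taking the basis `w` to the standard one. -/
noncomputable def rotatedRow {n l : ℕ} (w : OrthonormalBasis (Fin n) ℝ (EuclideanSpace ℝ (Fin n)))
    (G : Matrix (Fin n) (Fin l) ℝ) (i : Fin n) : EuclideanSpace ℝ (Fin l) :=
  Matrix.toEuclideanLin Gᵀ (w i)

theorem frobenius_norm_eq_sqrt {m n : ℕ} (M : Matrix (Fin m) (Fin n) ℝ) :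
    ‖M‖ = √(∑ i, ∑ j, M i j ^ 2) := by
  rw [Matrix.frobenius_norm_def, ← Real.sqrt_eq_rpow]
  simp

/-- Expand the Frobenius norm in the basis `w`. Outside `T` the projection is merely a contraction.
Inside `T`, the projection kills `A G (d c)`, which trades `A (w c)` for minus a combination of
vectors outside `T`. -/
theorem IsRangeFinder.norm_sub_sq_le {m n l : ℕ} {A : Matrix (Fin m) (Fin n) ℝ}
    {G : Matrix (Fin n) (Fin l) ℝ} {V : Matrix (Fin m) (Fin l) ℝ} (h : IsRangeFinder A G V)
    (w : OrthonormalBasis (Fin n) ℝ (EuclideanSpace ℝ (Fin n))) (T : Fin n → Prop)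
    [DecidablePred T] (d : {i // T i} → EuclideanSpace ℝ (Fin l))
    (hd : ∀ a c : {i // T i}, ⟪rotatedRow w G a, d c⟫ = if a = c then 1 else 0) :
    ‖A - V * (Vᵀ * A)‖ ^ 2 ≤ ∑ c : {i // ¬ T i}, ‖Matrix.toEuclideanLin A (w c)‖ ^ 2 +
      ∑ c : {i // T i}, ‖∑ i : {i // ¬ T i}, ⟪rotatedRow w G i, d c⟫ •
        Matrix.toEuclideanLin A (w i)‖ ^ 2 := by
  obtain ⟨hV, S, hS⟩ := h
  have hmul : ∀ {a b c : ℕ} (M : Matrix (Fin a) (Fin b) ℝ) (N : Matrix (Fin b) (Fin c) ℝ)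
      (y : EuclideanSpace ℝ (Fin c)), Matrix.toEuclideanLin (M * N) y
        = Matrix.toEuclideanLin M (Matrix.toEuclideanLin N y) := fun M N y => by
    simp [Matrix.toLpLin_apply, Matrix.mulVec_mulVec]
  have hE : A - V * (Vᵀ * A) = (1 - V * Vᵀ) * A := by
    rw [Matrix.sub_mul, Matrix.one_mul, Matrix.mul_assoc]
  have hAG : (1 - V * Vᵀ) * (A * G) = 0 := by
    rw [hS, Matrix.sub_mul, Matrix.one_mul, Matrix.mul_assoc, ← Matrix.mul_assoc Vᵀ, hV,
      Matrix.one_mul, sub_self]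
  have hG : ∀ v : EuclideanSpace ℝ (Fin l),
      Matrix.toEuclideanLin G v = ∑ i, ⟪rotatedRow w G i, v⟫ • w i := fun v => by
    rw [← w.sum_repr' (Matrix.toEuclideanLin G v)]
    refine Finset.sum_congr rfl fun i _ => ?_
    rw [rotatedRow, ← Matrix.conjTranspose_eq_transpose_of_trivial,
      Matrix.toEuclideanLin_conjTranspose_eq_adjoint, LinearMap.adjoint_inner_left]
  rw [frobenius_norm_sq_eq_sum_norm_toEuclideanLin _ w, hE, add_comm,
    ← Fintype.sum_subtype_add_sum_subtype T]
  refine add_le_add (Finset.sum_le_sum fun c _ => ?_) (Finset.sum_le_sum fun c _ => ?_)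
  · have h1 : Matrix.toEuclideanLin ((1 - V * Vᵀ) * A) (w c)
        = -Matrix.toEuclideanLin (1 - V * Vᵀ) (∑ i : {i // ¬ T i}, ⟪rotatedRow w G i, d c⟫ •
          Matrix.toEuclideanLin A (w i)) := by
      have h2 : Matrix.toEuclideanLin (1 - V * Vᵀ)
          (Matrix.toEuclideanLin A (Matrix.toEuclideanLin G (d c))) = 0 := by
        rw [← hmul, ← hmul, Matrix.mul_assoc, hAG]; simp
      rw [hG, ← Fintype.sum_subtype_add_sum_subtype T] at h2
      simp_rw [hd] at h2
      simp only [ite_smul, one_smul, zero_smul, Finset.sum_ite_eq', Finset.mem_univ, if_true,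
        map_add, map_sum, map_smul] at h2
      rw [hmul, eq_neg_iff_add_eq_zero, ← h2]
      simp only [map_sum, map_smul]
    rw [h1, norm_neg]
    gcongr
    exact norm_toEuclideanLin_one_sub_mul_transpose_le hV _
  · rw [hmul]
    gcongr
    exact norm_toEuclideanLin_one_sub_mul_transpose_le hV _

/-! ### Singular values and rotated Gaussian rows -/

theorem norm_toEuclideanLin_eigenvectorBasis_sq {m n : ℕ} (A : Matrix (Fin m) (Fin n) ℝ)
    (hn : Module.finrank ℝ (EuclideanSpace ℝ (Fin n)) = n) (i : Fin n) :
    ‖Matrix.toEuclideanLin A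
      ((Matrix.toEuclideanLin A).isSymmetric_adjoint_comp_self.eigenvectorBasis hn i)‖ ^ 2
      = singularValue A i ^ 2 := by
  set w := (Matrix.toEuclideanLin A).isSymmetric_adjoint_comp_self.eigenvectorBasis hn
  rw [singularValue, LinearMap.sq_singularValues_fin _ hn, ← real_inner_self_eq_norm_sq,
    ← LinearMap.adjoint_inner_right, ← LinearMap.comp_apply,
    LinearMap.IsSymmetric.apply_eigenvectorBasis, inner_smul_right,
    real_inner_self_eq_norm_sq, OrthonormalBasis.norm_eq_one]
  simp

/-- The rows of a rotated Gaussian matrix are independent standard Gaussian vectors. -/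
theorem IsGaussianMatrix.map_rotatedRow {S : Type*} [MeasurableSpace S] {μ : Measure S}
    [IsProbabilityMeasure μ] {n l : ℕ} {G : S → Matrix (Fin n) (Fin l) ℝ}
    (hG : IsGaussianMatrix μ G) (w : OrthonormalBasis (Fin n) ℝ (EuclideanSpace ℝ (Fin n))) :
    AEMeasurable (fun ω i => rotatedRow w (G ω) i) μ ∧
    μ.map (fun ω i => rotatedRow w (G ω) i)
      = Measure.pi fun _ => stdGaussian (EuclideanSpace ℝ (Fin l)) := by
  have hent : AEMeasurable (fun ω (ij : Fin n × Fin l) => G ω ij.1 ij.2) μ :=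
    aemeasurable_pi_lambda _ fun ij => (hG.1 ij.1 ij.2).aemeasurable
  have hlaw : μ.map (fun ω (ij : Fin n × Fin l) => G ω ij.1 ij.2)
      = Measure.pi fun _ => gaussianReal 0 1 := by
    have h1 := (iIndepFun_iff_map_fun_eq_pi_map
      fun ij : Fin n × Fin l => (hG.1 ij.1 ij.2).aemeasurable).1 hG.2
    refine h1.trans ?_
    congr 1
    ext1 ij
    exact (hG.1 ij.1 ij.2).map_eq
  let f : Fin n → EuclideanSpace ℝ (Fin n × Fin l) → EuclideanSpace ℝ (Fin l) :=
    fun i x => rotatedRow w (Matrix.of fun a b => x (a, b)) i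
  have hfapply : ∀ i x j, f i x j = ∑ k, x (k, j) * w i k := fun i x j => by
    simp [f, rotatedRow, Matrix.toLpLin_apply, Matrix.mulVec, dotProduct]
  have hf : ∀ i, Measurable (f i) := fun i => by
    have h1 : f i = fun x => WithLp.toLp 2 fun j => ∑ k, x (k, j) * w i k := by
      ext x j
      exact hfapply i x j
    rw [h1]
    fun_prop
  have hmap := map_stdGaussian_eq_pi (stdGaussian (EuclideanSpace ℝ (Fin l)))
    charFun_stdGaussian f hf fun t =>
      -- The adjoint of the joint rotation, applied to `t`; orthonormality of `w` makes it an
      -- isometry.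
      ⟨WithLp.toLp 2 fun kj => ∑ i, t i kj.2 * w i kj.1, fun x => by
        simp only [PiLp.inner_apply, hfapply, RCLike.inner_apply, conj_trivial,
          Fintype.sum_prod_type, Finset.sum_mul, Finset.mul_sum]
        rw [Finset.sum_comm]
        conv_rhs => rw [Finset.sum_comm]
        refine Finset.sum_congr rfl fun j _ => ?_
        rw [Finset.sum_comm]
        exact Finset.sum_congr rfl fun i _ => Finset.sum_congr rfl fun k _ => by ring, by
        simp_rw [EuclideanSpace.real_norm_sq_eq, Fintype.sum_prod_type]
        rw [Finset.sum_comm]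
        conv_rhs => rw [Finset.sum_comm]
        refine Finset.sum_congr rfl fun j _ => ?_
        have h1 : ∑ k, (∑ i, t i j * w i k) ^ 2 = ‖∑ i, t i j • w i‖ ^ 2 := by
          rw [EuclideanSpace.real_norm_sq_eq]
          simp
        rw [h1, ← real_inner_self_eq_norm_sq, w.orthonormal.inner_sum]
        simp [sq]⟩
  have hcomp : (fun ω i => rotatedRow w (G ω) i)
      = ((fun x i => f i x) ∘ WithLp.toLp 2) ∘ fun ω (ij : Fin n × Fin l) => G ω ij.1 ij.2 := rfl
  have hfm : Measurable fun (x : EuclideanSpace ℝ (Fin n × Fin l)) i => f i x :=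
    measurable_pi_iff.2 hf
  have hfm' : Measurable ((fun (x : EuclideanSpace ℝ (Fin n × Fin l)) i => f i x) ∘
      WithLp.toLp 2) := hfm.comp (by fun_prop)
  rw [hcomp]
  refine ⟨hfm'.comp_aemeasurable hent, ?_⟩
  rw [← AEMeasurable.map_map_of_aemeasurable hfm'.aemeasurable hent, hlaw,
    ← Measure.map_map hfm (by fun_prop), map_pi_eq_stdGaussian, hmap]

/-! ### Averaging over independent head and tail rows -/

theorem measurable_norm_sum_inner_gramDual {ι E : Type*} [Fintype ι] [DecidableEq ι]
    [NormedAddCommGroup E] [InnerProductSpace ℝ E] [FiniteDimensional ℝ E]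
    [MeasurableSpace E] [BorelSpace E] (T : ι → Prop) [DecidablePred T] {m : ℕ}
    (a : {i // ¬ T i} → EuclideanSpace ℝ (Fin m)) (c : {i // T i}) :
    Measurable fun x : ({i // T i} → E) × ({i // ¬ T i} → E) =>
      ENNReal.ofReal (‖∑ i, ⟪x.2 i, gramDual x.1 c⟫ • a i‖ ^ 2) := by
  have h1 := (measurable_gramDual (E := E) c).comp
    (measurable_fst : Measurable (Prod.fst : ({i // T i} → E) × ({i // ¬ T i} → E) → _))
  have h2 : ∀ i, Measurable fun x : ({i // T i} → E) × ({i // ¬ T i} → E) =>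
      ⟪x.2 i, gramDual x.1 c⟫ • a i := fun i =>
    (Measurable.inner ((measurable_pi_apply i).comp measurable_snd) h1).smul_const (a i)
  exact ((Finset.measurable_sum _ fun i _ => h2 i).norm.pow_const 2).ennreal_ofReal

theorem measurable_sum_norm_sum_inner_gramDual {ι E : Type*} [Fintype ι] [DecidableEq ι]
    [NormedAddCommGroup E] [InnerProductSpace ℝ E] [FiniteDimensional ℝ E]
    [MeasurableSpace E] [BorelSpace E] (T : ι → Prop) [DecidablePred T] {m : ℕ}
    (a : {i // ¬ T i} → EuclideanSpace ℝ (Fin m)) :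
    Measurable fun x : ι → E => ∑ c : {i // T i}, ENNReal.ofReal (‖∑ i : {i // ¬ T i},
      ⟪x i, gramDual (fun b : {i // T i} => x b) c⟫ • a i‖ ^ 2) := by
  refine Finset.measurable_sum _ fun c _ => ?_
  have h1 : Measurable fun x : ι → E =>
      ((fun b : {i // T i} => x b), fun b : {i // ¬ T i} => x b) := by fun_prop
  have h2 := (measurable_norm_sum_inner_gramDual (E := E) T a c).comp h1
  exact h2

/-- The dual vectors depend only on the rows in `T`. With these fixed, the remaining rows contribute
an exact second moment; then the mean of `‖gramDual y c‖ ^ 2` is bounded. -/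
theorem lintegral_sum_norm_sum_inner_gramDual_le {ι E : Type*} [Fintype ι] [DecidableEq ι]
    [NormedAddCommGroup E] [InnerProductSpace ℝ E] [FiniteDimensional ℝ E]
    [MeasurableSpace E] [BorelSpace E] (T : ι → Prop) [DecidablePred T] {m d : ℕ}
    (a : {i // ¬ T i} → EuclideanSpace ℝ (Fin m)) (hd : 3 ≤ d)
    (hE : Fintype.card {i // T i} + d ≤ Module.finrank ℝ E + 1) :
    ∫⁻ x : ι → E, ∑ c : {i // T i}, ENNReal.ofReal (‖∑ i : {i // ¬ T i},
        ⟪x i, gramDual (fun b : {i // T i} => x b) c⟫ • a i‖ ^ 2)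
        ∂Measure.pi (fun _ => stdGaussian E)
      ≤ Fintype.card {i // T i} *
        (ENNReal.ofReal (1 / ((d : ℝ) - 2)) * ENNReal.ofReal (∑ i, ‖a i‖ ^ 2)) := by
  have hmp := measurePreserving_piEquivPiSubtypeProd (fun _ : ι => stdGaussian E) T
  have hmeas := fun c => measurable_norm_sum_inner_gramDual (E := E) T a c
  calc _ = ∫⁻ x : ({i // T i} → E) × ({i // ¬ T i} → E), ∑ c : {i // T i},
        ENNReal.ofReal (‖∑ i, ⟪x.2 i, gramDual x.1 c⟫ • a i‖ ^ 2)
          ∂(Measure.pi fun _ : {i // T i} => stdGaussian E).prod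
            (Measure.pi fun _ : {i // ¬ T i} => stdGaussian E) :=
        hmp.lintegral_comp (Finset.measurable_sum _ fun c _ => hmeas c)
    _ = ∑ c : {i // T i}, ∫⁻ y : {i // T i} → E,
        ENNReal.ofReal (‖gramDual y c‖ ^ 2) * ENNReal.ofReal (∑ i, ‖a i‖ ^ 2)
          ∂Measure.pi (fun _ => stdGaussian E) := by
        rw [lintegral_finsetSum _ fun c _ => hmeas c]
        refine Finset.sum_congr rfl fun c _ => ?_
        rw [lintegral_prod _ (hmeas c).aemeasurable]
        refine lintegral_congr fun y => ?_
        change ∫⁻ z : {i // ¬ T i} → E, ENNReal.ofReal (‖∑ i, ⟪z i, gramDual y c⟫ • a i‖ ^ 2)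
          ∂Measure.pi (fun _ => stdGaussian E) = _
        rw [lintegral_norm_sum_inner_smul_sq, ENNReal.ofReal_mul (by positivity)]
    _ ≤ ∑ c : {i // T i},
        ENNReal.ofReal (1 / ((d : ℝ) - 2)) * ENNReal.ofReal (∑ i, ‖a i‖ ^ 2) := by
        refine Finset.sum_le_sum fun c _ => ?_
        rw [lintegral_mul_const _ ((measurable_gramDual c).norm.pow_const 2).ennreal_ofReal]
        gcongr
        exact lintegral_norm_gramDual_sq_le c hd hE
    _ = _ := by simp

theorem ae_linearIndependent_subtype_stdGaussian {ι E : Type*} [Fintype ι] [DecidableEq ι]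
    [NormedAddCommGroup E] [InnerProductSpace ℝ E] [FiniteDimensional ℝ E]
    [MeasurableSpace E] [BorelSpace E] (T : ι → Prop) [DecidablePred T]
    (hE : Fintype.card {i // T i} ≤ Module.finrank ℝ E) :
    ∀ᵐ x ∂Measure.pi (fun _ : ι => stdGaussian E),
      LinearIndependent ℝ fun b : {i // T i} => x b := by
  rw [Fintype.card_subtype] at hE
  filter_upwards [ae_linearIndepOn_stdGaussian _ hE] with x hx
  rw [LinearIndepOn] at hx
  exact hx.comp (fun b : {i // T i} => ⟨b, by simp⟩) fun b b' h => by
    simp_all [Subtype.ext_iff]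

/-! ### From the mean square to the expected error -/

theorem integral_le_sqrt_integral_sq {S : Type*} [MeasurableSpace S] {μ : Measure S}
    [IsProbabilityMeasure μ] {X : S → ℝ} (hX : MemLp X 2 μ) :
    ∫ ω, X ω ∂μ ≤ √(∫ ω, X ω ^ 2 ∂μ) := by
  have h := variance_nonneg X μ
  rw [variance_eq_sub hX] at h
  exact Real.le_sqrt_of_sq_le (by simpa using h)

theorem sum_subtype_not_lt_eq_sum_Ico {n k : ℕ} (f : ℕ → ℝ) :
    ∑ c : {i : Fin n // ¬ (i : ℕ) < k}, f c = ∑ j ∈ Finset.Ico k n, f j := by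
  refine Finset.sum_bij (fun c _ => ((c : Fin n) : ℕ)) (fun c _ => ?_) (fun c _ c' _ h => ?_)
    (fun j hj => ?_) fun _ _ => rfl
  · exact Finset.mem_Ico.2 ⟨not_lt.1 c.2, c.1.2⟩
  · exact Subtype.ext (Fin.ext h)
  · rw [Finset.mem_Ico] at hj
    exact ⟨⟨⟨j, hj.2⟩, not_lt.2 hj.1⟩, Finset.mem_univ _, rfl⟩

/-- The mean squared error of the range finder, for rows of the test matrix rotated to an
arbitrary orthonormal basis of the domain. -/
theorem lintegral_sq_norm_sub_rangeFinder_le {S : Type*} [MeasurableSpace S] {μ : Measure S}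
    [IsProbabilityMeasure μ] {m n k p : ℕ} (hp : 2 ≤ p) {A : Matrix (Fin m) (Fin n) ℝ}
    {G : S → Matrix (Fin n) (Fin (k + p)) ℝ} (hG : IsGaussianMatrix μ G)
    {V : S → Matrix (Fin m) (Fin (k + p)) ℝ} (hV : ∀ᵐ ω ∂μ, IsRangeFinder A (G ω) (V ω))
    (w : OrthonormalBasis (Fin n) ℝ (EuclideanSpace ℝ (Fin n))) :
    ∫⁻ ω, ENNReal.ofReal (‖A - V ω * ((V ω)ᵀ * A)‖ ^ 2) ∂μ ≤
      ENNReal.ofReal ((1 + (k : ℝ) / ((p : ℝ) - 1)) *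
        ∑ c : {i : Fin n // ¬ (i : ℕ) < k}, ‖Matrix.toEuclideanLin A (w c)‖ ^ 2) := by
  have hp' : (2 : ℝ) ≤ p := by exact_mod_cast hp
  let T : Fin n → Prop := fun i => (i : ℕ) < k
  -- Only an inequality, since `n` may be smaller than `k`.
  have hcard : Fintype.card {i // T i} ≤ k := by
    have h := Fintype.card_le_of_injective (fun i : {i // T i} => (⟨(i : Fin n), i.2⟩ : Fin k))
      fun a b h => Subtype.ext (Fin.ext (by simpa using h))
    simpa only [Fintype.card_fin] using h
  have hEfr : Module.finrank ℝ (EuclideanSpace ℝ (Fin (k + p))) = k + p := by simp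
  let a : {i // ¬ T i} → EuclideanSpace ℝ (Fin m) := fun i => Matrix.toEuclideanLin A (w i)
  change _ ≤ ENNReal.ofReal ((1 + (k : ℝ) / ((p : ℝ) - 1)) * ∑ c, ‖a c‖ ^ 2)
  set σ := ∑ c, ‖a c‖ ^ 2 with hσ
  have hσ0 : 0 ≤ σ := Finset.sum_nonneg fun j _ => sq_nonneg _
  obtain ⟨hrm, hrow⟩ := hG.map_rotatedRow w
  have hLI := ae_linearIndependent_subtype_stdGaussian
    (E := EuclideanSpace ℝ (Fin (k + p))) T (by rw [hEfr]; omega)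
  rw [← hrow] at hLI
  -- At most `k - 1` other head rows in dimension `k + p` leave `p + 1` free directions, whence `1 /
  -- (p + 1 - 2) = 1 / (p - 1)`.
  have hbound := lintegral_sum_norm_sum_inner_gramDual_le
    (E := EuclideanSpace ℝ (Fin (k + p))) T a (d := p + 1) (by omega) (by rw [hEfr]; omega)
  have hmeas := measurable_sum_norm_sum_inner_gramDual
    (E := EuclideanSpace ℝ (Fin (k + p))) T a
  rw [← hrow, lintegral_map' hmeas.aemeasurable hrm] at hbound
  have hp1 : (0 : ℝ) ≤ 1 / ((p + 1 : ℕ) - 2 : ℝ) := by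
    push_cast
    exact div_nonneg zero_le_one (by linarith)
  calc ∫⁻ ω, ENNReal.ofReal (‖A - V ω * ((V ω)ᵀ * A)‖ ^ 2) ∂μ
      ≤ ∫⁻ ω, (ENNReal.ofReal σ + ∑ c : {i // T i}, ENNReal.ofReal (‖∑ i : {i // ¬ T i},
          ⟪rotatedRow w (G ω) i, gramDual (fun b : {i // T i} => rotatedRow w (G ω) b) c⟫ •
            a i‖ ^ 2)) ∂μ := by
        refine lintegral_mono_ae ?_
        filter_upwards [hV, ae_of_ae_map hrm hLI] with ω h hli
        rw [← ENNReal.ofReal_sum_of_nonneg fun c _ => sq_nonneg _,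
          ← ENNReal.ofReal_add hσ0 (Finset.sum_nonneg fun c _ => sq_nonneg _)]
        refine ENNReal.ofReal_le_ofReal ?_
        exact h.norm_sub_sq_le w T
            (fun c => gramDual (fun b : {i // T i} => rotatedRow w (G ω) b) c)
            fun a c => inner_gramDual hli a c
    _ ≤ ENNReal.ofReal σ + k * (ENNReal.ofReal (1 / ((p + 1 : ℕ) - 2 : ℝ)) *
          ENNReal.ofReal σ) := by
        rw [lintegral_add_left measurable_const, lintegral_const, measure_univ, mul_one]
        gcongr
        refine hbound.trans ?_
        gcongr
    _ = ENNReal.ofReal ((1 + (k : ℝ) / ((p : ℝ) - 1)) * σ) := by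
        rw [← ENNReal.ofReal_natCast k, ← ENNReal.ofReal_mul hp1,
          ← ENNReal.ofReal_mul (by positivity), ← ENNReal.ofReal_add hσ0 (by positivity)]
        congr 1
        push_cast
        rw [show (p : ℝ) + 1 - 2 = p - 1 by ring]
        ring

theorem mainTheorem3 {S : Type*} [MeasurableSpace S] (μ : Measure S) [IsProbabilityMeasure μ]
    {m n k p r s : ℕ} (hk : 2 ≤ k) (hp : 2 < p)
    (A : Matrix (Fin m) (Fin n) ℝ)
    (G : S → Matrix (Fin n) (Fin (k + p)) ℝ) (hG : IsGaussianMatrix μ G)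
    (V : S → Matrix (Fin m) (Fin (k + p)) ℝ) (hV : ∀ i j, AEMeasurable (fun ω => V ω i j) μ)
    (Q : S → Matrix (Fin m) (Fin r) ℝ) (L : S → Matrix (Fin r) (Fin s) ℝ)
    (P : S → Matrix (Fin n) (Fin s) ℝ)
    (hQLP : ∀ᵐ ω ∂μ, IsRQLP A (G ω) (V ω) (Q ω) (L ω) (P ω)) :
    Integrable (fun ω => ‖A - Q ω * L ω * (P ω)ᵀ‖) μ ∧
      ∫ ω, ‖A - Q ω * L ω * (P ω)ᵀ‖ ∂μ ≤
        √(1 + (k : ℝ) / ((p : ℝ) - 1)) * √(∑ j ∈ Finset.Ico k n, singularValue A j ^ 2) := by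
  have hp' : (2 : ℝ) < p := by exact_mod_cast hp
  have hfr : Module.finrank ℝ (EuclideanSpace ℝ (Fin n)) = n := by simp
  let w := (Matrix.toEuclideanLin A).isSymmetric_adjoint_comp_self.eigenvectorBasis hfr
  set σ := ∑ j ∈ Finset.Ico k n, singularValue A j ^ 2 with hσ
  have hσ0 : 0 ≤ σ := Finset.sum_nonneg fun j _ => sq_nonneg _
  have haσ : ∑ c : {i : Fin n // ¬ (i : ℕ) < k}, ‖Matrix.toEuclideanLin A (w c)‖ ^ 2 = σ := by
    rw [hσ, ← sum_subtype_not_lt_eq_sum_Ico]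
    exact Finset.sum_congr rfl fun i _ => norm_toEuclideanLin_eigenvectorBasis_sq A hfr i
  -- Measurability is available for `V` but not assumed of `Q`, `L`, `P`, so the error is rewritten
  -- through `V` alone.
  let X : S → ℝ := fun ω => ‖A - V ω * ((V ω)ᵀ * A)‖
  have hXeq : (fun ω => ‖A - Q ω * L ω * (P ω)ᵀ‖) =ᵐ[μ] X := by
    filter_upwards [hQLP] with ω h
    rw [h.mul_mul_transpose]
  have hXmeas : AEMeasurable X μ := by
    simp only [X, frobenius_norm_eq_sqrt, Matrix.sub_apply, Matrix.mul_apply, Matrix.transpose_apply]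
    fun_prop
  have hXmem : MemLp X 2 μ := by
    refine MemLp.of_bound hXmeas.aestronglyMeasurable
      (√(∑ c : {i : Fin n // ¬ False}, ‖Matrix.toEuclideanLin A (w c)‖ ^ 2)) ?_
    filter_upwards [hQLP] with ω h
    rw [Real.norm_of_nonneg (norm_nonneg _)]
    refine Real.le_sqrt_of_sq_le ?_
    -- With an empty head the deterministic bound reads error at most `‖A‖`, so `X` is bounded.
    have h1 := h.1.norm_sub_sq_le w (fun _ => False) (fun c => c.2.elim) fun c => c.2.elim
    simpa using h1
  have hsq : ∫ ω, X ω ^ 2 ∂μ ≤ (1 + (k : ℝ) / ((p : ℝ) - 1)) * σ := by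
    rw [integral_eq_lintegral_of_nonneg_ae (ae_of_all _ fun ω => sq_nonneg _)
      (hXmeas.pow_const 2).aestronglyMeasurable]
    refine ENNReal.toReal_le_of_le_ofReal (mul_nonneg (by
      have : 0 ≤ (k : ℝ) / ((p : ℝ) - 1) := div_nonneg (by positivity) (by linarith)
      linarith) hσ0) ?_
    rw [← haσ]
    exact lintegral_sq_norm_sub_rangeFinder_le hp.le hG (hQLP.mono fun ω h => h.1) w
  refine ⟨(hXmem.integrable one_le_two).congr hXeq.symm, ?_⟩
  rw [integral_congr_ae hXeq, ← Real.sqrt_mul' _ hσ0]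
  exact (integral_le_sqrt_integral_sq hXmem).trans (Real.sqrt_le_sqrt hsq)
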